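/- Let $n\in\mathbb{N}$ and $k\ge 1$ be integers, let $\Omega\subset\mathbb{R}^n$ be compact, let $\phi:\Omega\times\mathbb{R}\times\mathbb{R}^n\to\mathbb{R}$ be continuous, and let $\tau>0$. Let $\sigma\in C^k(\mathbb{R})$ be any activation function that is not a polynomial. A function is called $C^k$ on $\Omega$ if it is $k$ times continuously differentiable on some open neighbourhood of $\Omega$. Let $g,h$ be real-valued $C^k$ functions on $\Omega$. For every $C^k$ function $u$ on $\Omega$ set $$\mathcal{I}(u)=\int_\Omega \phi(x,u(x),\nabla u(x))\,dx+\frac{d_{L^2(\Omega)}(u,h)^2}{2\tau},$$ where $d_{L^2(\Omega)}(u,h)=\|u-h\|_{L^2(\Omega)}$; both terms are well defined and finite. Then for every $\epsilon>0$ there is a neural network with one hidden layer and activation $\sigma$, $$u_\theta(x)=\sum_{j=1}^{N}a_j\,\sigma(y_j^{T}x+\theta_j),\qquad N\in\mathbb{N},\ a_j,\theta_j\in\mathbb{R},\ y_j\in\mathbb{R}^n,$$ (a $C^k$ function) such that $|u_\theta(x)-g(x)|\le\epsilon$ for all $x\in\Omega$, so that $\|u_\theta-g\|_{L^\infty(\Omega)}\le\epsilon$,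 and $\mathcal{I}(u_\theta)-\mathcal{I}(g)\le\epsilon$. -/

import Mathlib

open MeasureTheory Set

/-- `u` is of class `C^k` on the set `Ω ⊆ ℝⁿ`: it is `k` times continuously differentiable on some
open neighbourhood of `Ω`. In particular, for `1 ≤ k`, the gradient of `u` at the points of `Ω` is
the genuine one. Only the behaviour of the total function `u` near `Ω` matters. -/
def IsCkOn {n : ℕ} (k : ℕ) (u : EuclideanSpace ℝ (Fin n) → ℝ)
    (Ω : Set (EuclideanSpace ℝ (Fin n))) : Prop :=
  ∃ U : Set (EuclideanSpace ℝ (Fin n)), IsOpen U ∧ Ω ⊆ U ∧ ContDiffOn ℝ k u U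

/-- `G` is a network with one hidden layer and activation `σ`:
`G(x) = ∑ j, a j * σ (⟨y j, x⟩ + θ j)`, a finite sum. -/
def IsShallowNetwork {n : ℕ} (σ : ℝ → ℝ) (G : EuclideanSpace ℝ (Fin n) → ℝ) : Prop :=
  ∃ (N : ℕ) (a : Fin N → ℝ) (y : Fin N → EuclideanSpace ℝ (Fin n)) (θ : Fin N → ℝ),
    ∀ x, G x = ∑ j, a j * σ (inner ℝ (y j) x + θ j)

/-- `σ` is not (the function of) a real polynomial. -/
def IsNonPolynomial (σ : ℝ → ℝ) : Prop :=
  ¬ ∃ p : Polynomial ℝ, ∀ t, σ t = p.eval t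

/-- The `L²(Ω)` distance between `u` and `v`. -/
noncomputable def l2Dist {n : ℕ} (Ω : Set (EuclideanSpace ℝ (Fin n)))
    (u v : EuclideanSpace ℝ (Fin n) → ℝ) : ℝ :=
  (eLpNorm (fun x => u x - v x) 2 (volume.restrict Ω)).toReal

/-- The functional `I(u) = ∫_Ω φ(x, u(x), ∇u(x)) dx + d_{L²(Ω)}(u, h)² / (2τ)`. -/
noncomputable def movementFunctional {n : ℕ} (Ω : Set (EuclideanSpace ℝ (Fin n)))
    (φ : EuclideanSpace ℝ (Fin n) × ℝ × EuclideanSpace ℝ (Fin n) → ℝ) (τ : ℝ)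
    (h u : EuclideanSpace ℝ (Fin n) → ℝ) : ℝ :=
  (∫ x in Ω, φ (x, u x, gradient u x)) + l2Dist Ω u h ^ 2 / (2 * τ)

open Filter Topology
open scoped Convolution ContDiff FourierTransform SchwartzMap

/-! The functional is continuous in the 1-jet `(u, ∇u)` for the sup norm on `Ω`, so it suffices that
jets of networks are dense among jets of `C^k` functions. Let `M` be the closed span of the jets of
single neurons. Being a closed subspace, it is stable under Bochner integrals and under derivatives
in a parameter, and four such operations enlarge it step by step.

Averaging over the bias replaces `σ` by a smooth mollification `f`. Differentiating `f(l⟨y,x⟩ + θ)`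
`m` times in `l` at `l = 0` gives `f^(m)(θ)⟨y,x⟩^m`; since `σ` is not a polynomial, `f` and `θ` can
be chosen with `f^(m)(θ) ≠ 0`, so powers of `⟨y,x⟩` lie in `M` (`isJetIn_pow`). Weierstrass
approximation of the derivative of the profile yields all `C^1` ridge functions (`isJetIn_ridge`).
Fourier inversion writes a smooth compactly supported function as an integral of ridge functions
(`isJetIn_gradient_of_contDiff_infty`). Mollification and a cutoff then reach every `C^k` function
on `Ω`. -/

/-! ### Calculus in closed subspaces -/

theorem Submodule.integral_mem_of_isClosed {X V : Type*} [MeasurableSpace X] {μ : Measure X}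
    [NormedAddCommGroup V] [NormedSpace ℝ V] [CompleteSpace V] (M : Submodule ℝ V)
    (hM : IsClosed (M : Set V)) {f : X → V} (hf : ∀ x, f x ∈ M) : ∫ x, f x ∂μ ∈ M := by
  by_cases hi : Integrable f μ
  · by_contra hn
    obtain ⟨L, c, hL, hc⟩ := geometric_hahn_banach_closed_point M.convex hM hn
    have h0 : ∀ v ∈ M, L v = 0 := by
      intro v hv
      by_contra hne
      -- A functional bounded above on a subspace vanishes there: this multiple of `v` would take
      -- the value `c + 1`.
      have h1 := hL (((c + 1) / L v) • v) (M.smul_mem _ hv)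
      rw [map_smul, smul_eq_mul, div_mul_cancel₀ _ hne] at h1
      linarith
    have h2 : L (∫ x, f x ∂μ) = 0 := by
      rw [← L.integral_comp_comm hi]
      simp [h0 _ (hf _)]
    have h3 := hL 0 M.zero_mem
    rw [map_zero] at h3
    linarith
  · rw [integral_undef hi]
    exact M.zero_mem

/-- The pointwise fundamental theorem of calculus makes `F` a primitive of `F'` in the sup-norm
space, where the Banach-valued version applies. -/
theorem ContinuousMap.hasDerivAt_of_forall_apply {K V : Type*} [TopologicalSpace K]
    [CompactSpace K] [NormedAddCommGroup V] [NormedSpace ℝ V] [CompleteSpace V]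
    {F F' : ℝ → C(K, V)} (hF' : Continuous F')
    (h : ∀ l x, HasDerivAt (fun l => F l x) (F' l x) l) (l : ℝ) : HasDerivAt F (F' l) l := by
  have h1 : F = fun l => F 0 + ∫ s in (0 : ℝ)..l, F' s := by
    funext l
    ext x
    have h2 := (ContinuousMap.evalCLM ℝ x).intervalIntegral_comp_comm
      (hF'.intervalIntegrable (μ := volume) 0 l)
    simp only [ContinuousMap.evalCLM_apply] at h2
    rw [ContinuousMap.add_apply, ← h2, intervalIntegral.integral_eq_sub_of_hasDerivAt
      (fun s _ => h s x)]
    · abel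
    · exact ((ContinuousMap.evalCLM ℝ x).continuous.comp hF').intervalIntegrable _ _
  rw [h1]
  exact (intervalIntegral.integral_hasDerivAt_right (hF'.intervalIntegrable 0 l)
    (hF'.stronglyMeasurableAtFilter _ _) hF'.continuousAt).const_add _

theorem Submodule.hasDerivAt_mem_of_isClosed {V : Type*} [NormedAddCommGroup V] [NormedSpace ℝ V]
    (M : Submodule ℝ V) (hM : IsClosed (M : Set V)) {F : ℝ → V} {v : V} {l : ℝ}
    (h : HasDerivAt F v l) (hF : ∀ l, F l ∈ M) : v ∈ M := by
  have h1 := range_deriv_subset_closure_span_image F dense_univ (mem_range_self l)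
  rw [h.deriv] at h1
  refine hM.closure_subset_iff.2 ?_ h1
  exact Submodule.span_le.2 (by rintro _ ⟨s, -, rfl⟩; exact hF s)

/-! ### Polynomials and mollified activations -/

theorem Polynomial.exists_derivative_eq (q : Polynomial ℝ) {m : ℕ} (hq : q.degree < m) :
    ∃ A : Polynomial ℝ, A.derivative = q ∧ A.degree < (m + 1 : ℕ) := by
  refine ⟨∑ i ∈ Finset.range m,
    Polynomial.C (q.coeff i / (i + 1)) * Polynomial.X ^ (i + 1), ?_, ?_⟩
  · rw [Polynomial.derivative_sum]
    ext j
    rw [Polynomial.finsetSum_coeff, Finset.sum_eq_single j]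
    · rw [Polynomial.derivative_C_mul_X_pow]
      simp only [Nat.add_sub_cancel, Polynomial.coeff_C_mul_X_pow, if_true]
      push_cast
      field_simp
    · intro i _ hij
      rw [Polynomial.derivative_C_mul_X_pow]
      simp [hij.symm, -map_mul]
    · intro hj
      rw [Polynomial.coeff_eq_zero_of_degree_lt (hq.trans_le _)]
      · simp
      · exact_mod_cast not_lt.1 (by simpa using hj)
  · refine (Polynomial.degree_sum_le _ _).trans_lt ?_
    rw [Finset.sup_lt_iff (by exact WithBot.bot_lt_coe _)]
    intro i hi
    refine (Polynomial.degree_C_mul_X_pow_le _ _).trans_lt ?_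
    exact_mod_cast Nat.succ_lt_succ (Finset.mem_range.1 hi)

theorem exists_polynomial_of_hasDerivAt {f : ℝ → ℝ} (q : Polynomial ℝ) {m : ℕ}
    (hq : q.degree < m) (hf : ∀ t, HasDerivAt f (q.eval t) t) :
    ∃ p : Polynomial ℝ, p.degree < (m + 1 : ℕ) ∧ ∀ t, f t = p.eval t := by
  obtain ⟨A, hA, hdeg⟩ := q.exists_derivative_eq hq
  have hc : ∀ t, f t - A.eval t = f 0 - A.eval 0 := by
    intro t
    refine is_const_of_deriv_eq_zero (f := fun t => f t - A.eval t) ?_ ?_ t 0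
    · exact fun s => ((hf s).sub (A.hasDerivAt s)).differentiableAt
    · intro s
      have := ((hf s).sub (A.hasDerivAt s)).deriv
      rw [hA, sub_self] at this
      exact this
  refine ⟨A + Polynomial.C (f 0 - A.eval 0), ?_, fun t => ?_⟩
  · refine (Polynomial.degree_add_le _ _).trans_lt (max_lt hdeg ?_)
    exact Polynomial.degree_C_le.trans_lt (by exact_mod_cast Nat.succ_pos m)
  · simp only [Polynomial.eval_add, Polynomial.eval_C]
    linarith [hc t]

/-- The degree bound matters: it lets a sequence of such polynomials be recovered from its values at
`m` fixed nodes. -/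
theorem exists_polynomial_of_iteratedDeriv_eq_zero (m : ℕ) {f : ℝ → ℝ} (hf : ContDiff ℝ ∞ f)
    (h : ∀ t, iteratedDeriv m f t = 0) :
    ∃ p : Polynomial ℝ, p.degree < m ∧ ∀ t, f t = p.eval t := by
  induction m generalizing f with
  | zero => exact ⟨0, by simp, fun t => by simpa using h t⟩
  | succ m ih =>
    have hd : ContDiff ℝ ∞ (deriv f) := (contDiff_infty_iff_deriv.1 hf).2
    obtain ⟨q, hq, hfq⟩ := ih hd fun t => by rw [← iteratedDeriv_succ']; exact h t
    refine exists_polynomial_of_hasDerivAt q hq fun t => ?_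
    rw [← hfq]
    exact ((hf.differentiable (by simp)) t).hasDerivAt

/-- If `σ` is not a polynomial then for each `m` some mollification of `σ` has a nonvanishing
`m`-th derivative. -/
theorem IsNonPolynomial.exists_iteratedDeriv_convolution_ne_zero {σ : ℝ → ℝ}
    (hσ : Continuous σ) (hp : IsNonPolynomial σ) (m : ℕ) :
    ∃ (φ : ContDiffBump (0 : ℝ)) (θ : ℝ),
      iteratedDeriv m (φ.normed volume ⋆[ContinuousLinearMap.lsmul ℝ ℝ, volume] σ) θ ≠ 0 := by
  by_contra! hcon
  let φ : ℕ → ContDiffBump (0 : ℝ) := fun j =>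
    ⟨1 / (j + 1) / 2, 1 / (j + 1), by positivity, half_lt_self (by positivity)⟩
  have hlim : ∀ t, Tendsto (fun j => ((φ j).normed volume
      ⋆[ContinuousLinearMap.lsmul ℝ ℝ, volume] σ) t) atTop (𝓝 (σ t)) :=
    ContDiffBump.convolution_tendsto_right_of_continuous
      tendsto_one_div_add_atTop_nhds_zero_nat hσ
  -- Each mollification equals its Lagrange interpolant at `0, …, m - 1`. As the nodes do not depend
  -- on `j`, the pointwise limit `σ` is a polynomial too.
  have hpoly : ∀ j t, ((φ j).normed volume ⋆[ContinuousLinearMap.lsmul ℝ ℝ, volume] σ) t =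
      ∑ i : Fin m, ((φ j).normed volume ⋆[ContinuousLinearMap.lsmul ℝ ℝ, volume] σ) (i : ℝ) *
        (Lagrange.basis Finset.univ (fun i : Fin m => ((i : ℕ) : ℝ)) i).eval t := by
    intro j t
    obtain ⟨p, hpd, hpe⟩ := exists_polynomial_of_iteratedDeriv_eq_zero m
      ((φ j).hasCompactSupport_normed.contDiff_convolution_left (n := ⊤)
        (ContinuousLinearMap.lsmul ℝ ℝ) (φ j).contDiff_normed hσ.locallyIntegrable) (hcon (φ j))
    have := Lagrange.eq_interpolate (s := Finset.univ) (v := fun i : Fin m => ((i : ℕ) : ℝ))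
      (f := p) (fun a _ b _ hab => Fin.ext (Nat.cast_injective hab)) (by simpa using hpd)
    rw [hpe t]
    conv_lhs => rw [this]
    simp only [Lagrange.interpolate_apply, Polynomial.eval_finsetSum, Polynomial.eval_mul,
      Polynomial.eval_C, hpe]
  refine hp ⟨∑ i : Fin m, Polynomial.C (σ (i : ℝ)) *
    Lagrange.basis Finset.univ (fun i : Fin m => ((i : ℕ) : ℝ)) i, fun t => ?_⟩
  refine tendsto_nhds_unique (hlim t) ?_
  simp only [hpoly _ t, Polynomial.eval_finsetSum, Polynomial.eval_mul, Polynomial.eval_C]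
  exact tendsto_finsetSum _ fun i _ => (hlim _).mul_const _

/-- Putting the derivative on `σ` keeps profile and derivative paired when a ridge jet is averaged
over its bias. -/
theorem hasDerivAt_convolution_of_contDiff_right {φ σ : ℝ → ℝ} (hφ : Continuous φ)
    (hφs : HasCompactSupport φ) (hσ : ContDiff ℝ 1 σ) (t : ℝ) :
    HasDerivAt (φ ⋆[ContinuousLinearMap.lsmul ℝ ℝ, volume] σ)
      ((φ ⋆[ContinuousLinearMap.lsmul ℝ ℝ, volume] deriv σ) t) t := by
  have hσc := hσ.continuous
  have hσ' : Continuous (deriv σ) := hσ.continuous_deriv le_rfl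
  obtain ⟨C, hC⟩ := (((isCompact_closedBall t 1).prod hφs.isCompact).image
    (f := fun p : ℝ × ℝ => deriv σ (p.1 - p.2)) (by fun_prop)).isBounded.exists_norm_le
  refine (hasDerivAt_integral_of_dominated_loc_of_deriv_le (Metric.closedBall_mem_nhds t one_pos)
    (F := fun x s => φ s * σ (x - s)) (F' := fun x s => φ s * deriv σ (x - s))
    (bound := fun s => ‖φ s‖ * C)
    (.of_forall fun x => Continuous.aestronglyMeasurable (by fun_prop)) ?_
    (Continuous.aestronglyMeasurable (by fun_prop)) (.of_forall fun s x hx => ?_) ?_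
    (.of_forall fun s x _ => ?_)).2
  · exact (by fun_prop : Continuous _).integrable_of_hasCompactSupport hφs.mul_right
  · rw [norm_mul]
    by_cases hs : s ∈ tsupport φ
    · gcongr
      exact hC _ ⟨(x, s), ⟨hx, hs⟩, rfl⟩
    · simp [image_eq_zero_of_notMem_tsupport hs]
  · exact (hφ.integrable_of_hasCompactSupport hφs).norm.mul_const C
  · have := ((hσ.differentiable one_ne_zero (x - s)).hasDerivAt).comp x
      ((hasDerivAt_id x).sub_const s)
    rw [mul_one] at this
    exact this.const_mul _

/-! ### Jets of ridge functions -/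

/-- The pair `(u, u')`, restricted to `K`, belongs to the space `M` of pairs of continuous
functions on `K`. -/
def IsJetIn {E : Type*} [NormedAddCommGroup E] [InnerProductSpace ℝ E] {K : Set E}
    (M : Submodule ℝ C(K, ℝ × E)) (u : E → ℝ) (u' : E → E) : Prop :=
  ∃ F ∈ M, ∀ x : K, F x = (u x, u' x)

/-- `M` contains the `1`-jets of all ridge functions with profile `f`, whose derivative is `f'`. -/
def ContainsRidges {E : Type*} [NormedAddCommGroup E] [InnerProductSpace ℝ E] {K : Set E}
    (M : Submodule ℝ C(K, ℝ × E)) (f f' : ℝ → ℝ) : Prop :=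
  ∀ (y : E) (θ : ℝ), IsJetIn M (fun x => f (inner ℝ y x + θ)) (fun x => f' (inner ℝ y x + θ) • y)

section Ridge

variable {E : Type*} [NormedAddCommGroup E] [InnerProductSpace ℝ E] {K : Set E}
  {M : Submodule ℝ C(K, ℝ × E)}

theorem IsJetIn.mem {u : E → ℝ} {u' : E → E} (h : IsJetIn M u u') {F : C(K, ℝ × E)}
    (hF : ∀ x : K, F x = (u x, u' x)) : F ∈ M := by
  obtain ⟨G, hG, hGx⟩ := h
  rwa [show F = G from ContinuousMap.ext fun x => by rw [hF, hGx]]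

theorem IsJetIn.add {u v : E → ℝ} {u' v' : E → E} (hu : IsJetIn M u u') (hv : IsJetIn M v v') :
    IsJetIn M (fun x => u x + v x) (fun x => u' x + v' x) := by
  obtain ⟨F, hF, hFx⟩ := hu
  obtain ⟨G, hG, hGx⟩ := hv
  exact ⟨F + G, M.add_mem hF hG, fun x => by rw [ContinuousMap.add_apply, hFx, hGx]; rfl⟩

theorem IsJetIn.const_mul {u : E → ℝ} {u' : E → E} (hu : IsJetIn M u u') (c : ℝ) :
    IsJetIn M (fun x => c * u x) (fun x => c • u' x) := by
  obtain ⟨F, hF, hFx⟩ := hu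
  exact ⟨c • F, M.smul_mem c hF, fun x => by rw [ContinuousMap.smul_apply, hFx]; rfl⟩

theorem IsJetIn.congr {u v : E → ℝ} {u' v' : E → E} (hu : IsJetIn M u u')
    (h : ∀ x, v x = u x) (h' : ∀ x, v' x = u' x) : IsJetIn M v v' := by
  rwa [show v = u from funext h, show v' = u' from funext h']

/-- The new jet is the Bochner integral over `s` of `φ s` times the jet with bias `θ - s`, and `M`
is closed. -/
theorem ContainsRidges.convolution [CompactSpace K] [CompleteSpace E]
    (hM : IsClosed (M : Set C(K, ℝ × E))) {f f' : ℝ → ℝ} (hf : Continuous f)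
    (hf' : Continuous f') (h : ContainsRidges M f f')
    {φ : ℝ → ℝ} (hφ : Continuous φ) (hφs : HasCompactSupport φ) :
    ContainsRidges M (φ ⋆[ContinuousLinearMap.lsmul ℝ ℝ, volume] f)
      (φ ⋆[ContinuousLinearMap.lsmul ℝ ℝ, volume] f') := by
  intro y θ
  let c : C(ℝ, C(K, ℝ × E)) := ContinuousMap.curry
    ⟨fun p : ℝ × K => φ p.1 • (f (inner ℝ y (p.2 : E) + θ - p.1),
      f' (inner ℝ y (p.2 : E) + θ - p.1) • y), by fun_prop⟩
  have hc : ∀ s x, c s x = φ s • (f (inner ℝ y (x : E) + θ - s),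
      f' (inner ℝ y (x : E) + θ - s) • y) := fun s x => rfl
  have hci : Integrable c volume := by
    refine c.continuous.integrable_of_hasCompactSupport (hφs.mono fun s hs => ?_)
    contrapose! hs
    rw [Function.notMem_support] at hs ⊢
    ext1 x
    rw [hc, hs, zero_smul]
    rfl
  refine ⟨∫ s, c s, M.integral_mem_of_isClosed hM fun s => ?_, fun x => ?_⟩
  · refine IsJetIn.mem (((h y (θ - s)).const_mul (φ s))) fun x => ?_
    rw [hc, add_sub_assoc]
    rfl
  · have h1 := (ContinuousMap.evalCLM ℝ x).integral_comp_comm hci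
    simp only [ContinuousMap.evalCLM_apply, hc] at h1
    have hi : ∀ g : ℝ → ℝ, Continuous g →
        Integrable (fun s => φ s * g (inner ℝ y (x : E) + θ - s)) volume := fun g hg =>
      (by fun_prop : Continuous _).integrable_of_hasCompactSupport hφs.mul_right
    rw [← h1]
    simp only [Prod.smul_mk, smul_smul, smul_eq_mul]
    rw [integral_pair (hi f hf) ((hi f' hf').smul_const y), integral_smul_const]
    rfl

/-- The jet is the `m`-th derivative in `l` of the ridge jet with direction `l • y`. -/
theorem ContainsRidges.isJetIn_pow_mul_iteratedDeriv [CompactSpace K] [CompleteSpace E]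
    (hM : IsClosed (M : Set C(K, ℝ × E))) {f : ℝ → ℝ} (hf : ContDiff ℝ ∞ f)
    (h : ContainsRidges M f (deriv f)) (y : E) (θ : ℝ) (m : ℕ) (l : ℝ) :
    IsJetIn M (fun x => inner ℝ y x ^ m * iteratedDeriv m f (l * inner ℝ y x + θ))
      (fun x => (m * inner ℝ y x ^ (m - 1) * iteratedDeriv m f (l * inner ℝ y x + θ) +
        l * inner ℝ y x ^ m * iteratedDeriv (m + 1) f (l * inner ℝ y x + θ)) • y) := by
  have hcd : ∀ m, Continuous (iteratedDeriv m f) := fun m =>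
    hf.continuous_iteratedDeriv m (by exact_mod_cast le_top)
  have hder : ∀ m (l t : ℝ), HasDerivAt (fun l => iteratedDeriv m f (l * t + θ))
      (t * iteratedDeriv (m + 1) f (l * t + θ)) l := by
    intro m l t
    have h1 : HasDerivAt (iteratedDeriv m f) (iteratedDeriv (m + 1) f (l * t + θ)) (l * t + θ) := by
      rw [iteratedDeriv_succ]
      exact (hf.differentiable_iteratedDeriv m (by exact_mod_cast ENat.natCast_lt_top m) _).hasDerivAt
    have h2 := h1.comp l (((hasDerivAt_id l).mul_const t).add_const θ)
    rw [one_mul, mul_comm] at h2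
    exact h2
  let c : ℕ → C(ℝ, C(K, ℝ × E)) := fun m => ContinuousMap.curry
    ⟨fun p : ℝ × K => (inner ℝ y (p.2 : E) ^ m * iteratedDeriv m f (p.1 * inner ℝ y (p.2 : E) + θ),
      (m * inner ℝ y (p.2 : E) ^ (m - 1) * iteratedDeriv m f (p.1 * inner ℝ y (p.2 : E) + θ) +
        p.1 * inner ℝ y (p.2 : E) ^ m *
          iteratedDeriv (m + 1) f (p.1 * inner ℝ y (p.2 : E) + θ)) • y), by
        have := hcd m
        have := hcd (m + 1)
        fun_prop⟩
  suffices hc : ∀ l, c m l ∈ M from ⟨c m l, hc l, fun x => rfl⟩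
  clear l
  induction m with
  | zero =>
    intro l
    refine (h (l • y) θ).mem fun x => ?_
    change (_, _) = _
    simp [inner_smul_left, smul_smul, iteratedDeriv_one, mul_comm]
  | succ m ih =>
    intro l
    refine M.hasDerivAt_mem_of_isClosed hM (ContinuousMap.hasDerivAt_of_forall_apply
      (c (m + 1)).continuous (F := c m) (fun l x => ?_) l) ih
    refine HasDerivAt.prodMk ?_ (HasDerivAt.smul_const ?_ y)
    · convert! (hder m l (inner ℝ y (x : E))).const_mul (inner ℝ y (x : E) ^ m) using 1
      ring
    · convert! ((hder m l (inner ℝ y (x : E))).const_mul (m * inner ℝ y (x : E) ^ (m - 1))).add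
        (((hasDerivAt_id l).mul_const (inner ℝ y (x : E) ^ m)).mul
          (hder (m + 1) l (inner ℝ y (x : E)))) using 1
      -- The exponent `m - 1` is truncated at `m = 0`, where its coefficient vanishes.
      rcases m with _ | m
      · simp; ring
      · simp only [Nat.add_sub_cancel, id]; push_cast; ring

/-- At `l = 0` the factor `iteratedDeriv m f θ` is a nonzero constant to divide by, and the gradient
term carrying `l` disappears. -/
theorem isJetIn_pow [CompactSpace K] [CompleteSpace E]
    (hM : IsClosed (M : Set C(K, ℝ × E))) {σ : ℝ → ℝ} (hσ : ContDiff ℝ 1 σ)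
    (hp : IsNonPolynomial σ) (h : ContainsRidges M σ (deriv σ)) (y : E) (m : ℕ) :
    IsJetIn M (fun x => inner ℝ y x ^ m) (fun x => (m * inner ℝ y x ^ (m - 1) : ℝ) • y) := by
  obtain ⟨φ, θ, hne⟩ := hp.exists_iteratedDeriv_convolution_ne_zero hσ.continuous m
  set f := (φ.normed volume ⋆[ContinuousLinearMap.lsmul ℝ ℝ, volume] σ) with hf_def
  have hf : ContDiff ℝ ∞ f := φ.hasCompactSupport_normed.contDiff_convolution_left (n := ⊤)
        (ContinuousLinearMap.lsmul ℝ ℝ) φ.contDiff_normed hσ.continuous.locallyIntegrable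
  have hf' : deriv f = (φ.normed volume ⋆[ContinuousLinearMap.lsmul ℝ ℝ, volume] deriv σ) := 
    funext fun t => (hasDerivAt_convolution_of_contDiff_right φ.continuous_normed
      φ.hasCompactSupport_normed hσ t).deriv
  have hr := h.convolution hM hσ.continuous (hσ.continuous_deriv le_rfl)
    (φ := φ.normed volume) φ.continuous_normed φ.hasCompactSupport_normed
  rw [← hf', ← hf_def] at hr
  refine ((hr.isJetIn_pow_mul_iteratedDeriv hM hf y θ m 0).const_mul
    (iteratedDeriv m f θ)⁻¹).congr (fun x => ?_) fun x => ?_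
  · simp only [zero_mul, zero_add]
    field_simp
  · simp only [zero_mul, zero_add, add_zero, smul_smul]
    congr 1
    field_simp

theorem isJetIn_polynomial (h : ∀ (y : E) (m : ℕ), IsJetIn M (fun x => inner ℝ y x ^ m)
      (fun x => (m * inner ℝ y x ^ (m - 1) : ℝ) • y)) (y : E) (p : Polynomial ℝ) :
    IsJetIn M (fun x => p.eval (inner ℝ y x)) (fun x => p.derivative.eval (inner ℝ y x) • y) := by
  induction p using Polynomial.induction_on' with
  | add p q hp hq =>
    refine (hp.add hq).congr (fun x => ?_) fun x => ?_ <;> simp [add_smul]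
  | monomial m a =>
    refine ((h y m).const_mul a).congr (fun x => ?_) fun x => ?_
    · simp
    · simp [Polynomial.derivative_monomial, smul_smul, mul_assoc]

theorem isJetIn_ridge [CompactSpace K] [CompleteSpace E]
    (hM : IsClosed (M : Set C(K, ℝ × E))) (h : ∀ (y : E) (m : ℕ),
      IsJetIn M (fun x => inner ℝ y x ^ m) (fun x => (m * inner ℝ y x ^ (m - 1) : ℝ) • y))
    {f f' : ℝ → ℝ} (hf : ∀ t, HasDerivAt f (f' t) t) (hf' : Continuous f') (y : E) :
    IsJetIn M (fun x => f (inner ℝ y x)) (fun x => f' (inner ℝ y x) • y) := by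
  have hfc : Continuous f := continuous_iff_continuousAt.2 fun t => (hf t).continuousAt
  let F : C(K, ℝ × E) :=
    ⟨fun x => (f (inner ℝ y (x : E)), f' (inner ℝ y (x : E)) • y), by fun_prop⟩
  refine ⟨F, ?_, fun x => rfl⟩
  obtain ⟨R, hR0, hR⟩ : ∃ R : ℝ, 0 ≤ R ∧ ∀ x : K, |inner ℝ y (x : E)| ≤ R := by
    obtain ⟨R, hR⟩ := (isCompact_range (f := fun x : K => inner ℝ y (x : E))
      (by fun_prop)).isBounded.exists_norm_le
    exact ⟨max R 0, le_max_right _ _, fun x => (hR _ ⟨x, rfl⟩).trans (le_max_left _ _)⟩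
  refine Metric.mem_of_closed' hM |>.2 fun ε hε => ?_
  -- With tolerance `δ` for `f'`, the values are off by at most `δ * R` and the gradients by `δ *
  -- ‖y‖`; this `δ` makes both at most `ε / 2`.
  obtain ⟨q, hq⟩ := exists_polynomial_near_of_continuousOn (-R) R f' hf'.continuousOn
    (ε / 2 / (R + ‖y‖ + 1)) (by positivity)
  obtain ⟨A, hA, -⟩ := q.exists_derivative_eq (m := q.natDegree + 1)
    (Polynomial.degree_le_natDegree.trans_lt (by exact_mod_cast Nat.lt_succ_self _))
  -- The constant makes the primitive agree with `f` at `0`, so the mean value inequality from `0`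
  -- bounds the error.
  obtain ⟨G, hG, hGx⟩ := isJetIn_polynomial h y (A + Polynomial.C (f 0 - A.eval 0))
  refine ⟨G, hG, ?_⟩
  rw [dist_comm]
  refine ((ContinuousMap.dist_le (half_pos hε).le).2 fun x => ?_).trans_lt (half_lt_self hε)
  have hδ : ε / 2 / (R + ‖y‖ + 1) * (R + ‖y‖ + 1) = ε / 2 := by field_simp
  have hδ0 : 0 < ε / 2 / (R + ‖y‖ + 1) := by positivity
  set δ := ε / 2 / (R + ‖y‖ + 1)
  have hx := hR x
  have hx' := abs_le.1 hx
  have h1 : |A.eval (inner ℝ y (x : E)) - f (inner ℝ y (x : E)) - (A.eval 0 - f 0)| ≤ δ * R := by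
    have h2 := (convex_Icc (-R) R).norm_image_sub_le_of_norm_hasDerivWithin_le
      (f := fun t => A.eval t - f t) (f' := fun t => q.eval t - f' t) (C := δ)
      (fun t _ => by
        have := (A.hasDerivAt t).sub (hf t)
        rw [hA] at this
        exact this.hasDerivWithinAt)
      (fun t ht => (hq t ht).le) (x := 0) (y := inner ℝ y (x : E)) ⟨by linarith, hR0⟩ hx'
    refine h2.trans ?_
    rw [sub_zero]
    exact mul_le_mul_of_nonneg_left hx hδ0.le
  rw [hGx, Prod.dist_eq]
  refine max_le ?_ ?_
  · have : dist ((A + Polynomial.C (f 0 - A.eval 0)).eval (inner ℝ y (x : E)))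
        (f (inner ℝ y (x : E))) ≤ δ * R := by
      rw [Real.dist_eq]
      convert h1 using 2
      simp
      ring
    refine this.trans ?_
    rw [← hδ]
    gcongr
    linarith [norm_nonneg y]
  · change dist ((A + Polynomial.C (f 0 - A.eval 0)).derivative.eval (inner ℝ y (x : E)) • y)
      (f' (inner ℝ y (x : E)) • y) ≤ _
    rw [dist_eq_norm, ← sub_smul, norm_smul, Polynomial.derivative_add, Polynomial.derivative_C,
      add_zero, hA, ← hδ]
    have := (hq _ hx').le
    rw [← Real.norm_eq_abs] at this
    gcongr
    linarith [norm_nonneg y]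

end Ridge

/-! ### From ridge functions to compactly supported functions -/

section Density

variable {E : Type*} [NormedAddCommGroup E] [InnerProductSpace ℝ E] {K : Set E}
  {M : Submodule ℝ C(K, ℝ × E)}

theorem hasGradientAt_comp_inner_add [CompleteSpace E] {f : ℝ → ℝ} {d : ℝ} {y x : E} {θ : ℝ}
    (hf : HasDerivAt f d (inner ℝ y x + θ)) :
    HasGradientAt (fun x => f (inner ℝ y x + θ)) (d • y) x := by
  have h1 : HasFDerivAt (fun x => inner ℝ y x + θ) (innerSL ℝ y) x :=
    (innerSL ℝ y).hasFDerivAt.add_const θ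
  rw [hasGradientAt_iff_hasFDerivAt]
  refine (hf.comp_hasFDerivAt x h1).congr_fderiv ?_
  ext v
  simp

variable [FiniteDimensional ℝ E]

/-- The real part of the Fourier inversion formula exhibits `g` as an integral over `ξ` of ridge
functions with direction `ξ`. Schwartz decay of the transform gives integrable bounds on the ridge
functions and their gradients, so the integral converges as a Bochner integral of jets. -/
theorem isJetIn_gradient_of_contDiff_infty [CompactSpace K]
    (hM : IsClosed (M : Set C(K, ℝ × E)))
    (h : ∀ f f' : ℝ → ℝ, (∀ t, HasDerivAt f (f' t) t) → Continuous f' → ∀ y : E,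
      IsJetIn M (fun x => f (inner ℝ y x)) (fun x => f' (inner ℝ y x) • y))
    {g : E → ℝ} (hg : ContDiff ℝ ∞ g) (hgs : HasCompactSupport g) :
    IsJetIn M g (gradient g) := by
  borelize E
  let G : 𝓢(E, ℂ) := HasCompactSupport.toSchwartzMap (f := fun x => (g x : ℂ))
    (hgs.comp_left Complex.ofReal_zero) (Complex.ofRealCLM.contDiff.comp hg)
  let H : 𝓢(E, ℂ) := 𝓕 G
  let f : E → ℝ → ℝ := fun ξ t =>
    (H ξ).re * Real.cos (2 * Real.pi * t) - (H ξ).im * Real.sin (2 * Real.pi * t)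
  let f' : E → ℝ → ℝ := fun ξ t => 2 * Real.pi *
    (-(H ξ).re * Real.sin (2 * Real.pi * t) - (H ξ).im * Real.cos (2 * Real.pi * t))
  have hH : Continuous H := H.continuous
  have hf : ∀ ξ t, HasDerivAt (f ξ) (f' ξ t) t := by
    intro ξ t
    have h1 : HasDerivAt (fun t : ℝ => 2 * Real.pi * t) (2 * Real.pi) t := by
      simpa using (hasDerivAt_id t).const_mul (2 * Real.pi)
    convert! (h1.cos.const_mul (H ξ).re).sub (h1.sin.const_mul (H ξ).im) using 1
    simp only [f']
    ring
  have hre : ∀ ξ, |(H ξ).re| ≤ ‖H ξ‖ := fun ξ => Complex.abs_re_le_norm _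
  have him : ∀ ξ, |(H ξ).im| ≤ ‖H ξ‖ := fun ξ => Complex.abs_im_le_norm _
  have hmul : ∀ a b c : ℝ, |a| ≤ c → |b| ≤ 1 → |a * b| ≤ c := fun a b c ha hb => by
    rw [abs_mul]
    exact (mul_le_of_le_one_right (abs_nonneg a) hb).trans ha
  have hfb : ∀ ξ t, ‖f ξ t‖ ≤ 2 * ‖H ξ‖ := by
    intro ξ t
    refine (abs_sub _ _).trans ?_
    linarith [hmul _ _ _ (hre ξ) (Real.abs_cos_le_one (2 * Real.pi * t)),
      hmul _ _ _ (him ξ) (Real.abs_sin_le_one (2 * Real.pi * t))]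
  have hfb' : ∀ ξ t, ‖f' ξ t • ξ‖ ≤ 2 * Real.pi * 2 * (‖ξ‖ * ‖H ξ‖) := by
    intro ξ t
    rw [norm_smul, Real.norm_eq_abs, abs_mul, abs_of_pos Real.two_pi_pos]
    have : |-(H ξ).re * Real.sin (2 * Real.pi * t) - (H ξ).im * Real.cos (2 * Real.pi * t)|
        ≤ 2 * ‖H ξ‖ := by
      refine (abs_sub _ _).trans ?_
      linarith [hmul (-(H ξ).re) _ _ ((abs_neg _).trans_le (hre ξ))
        (Real.abs_sin_le_one (2 * Real.pi * t)),
        hmul _ _ _ (him ξ) (Real.abs_cos_le_one (2 * Real.pi * t))]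
    calc _ ≤ 2 * Real.pi * (2 * ‖H ξ‖) * ‖ξ‖ := by gcongr
      _ = _ := by ring
  have hHi : Integrable (fun ξ => 2 * ‖H ξ‖) volume := H.integrable.norm.const_mul 2
  have hHi' : Integrable (fun ξ => 2 * Real.pi * 2 * (‖ξ‖ * ‖H ξ‖)) volume := by
    simpa using (H.integrable_pow_mul volume 1).const_mul (2 * Real.pi * 2)
  have hfc : ∀ x : E, Continuous fun ξ => f ξ (inner ℝ ξ x) := by
    intro x
    simp only [f]
    fun_prop
  have hfc' : ∀ x : E, Continuous fun ξ => f' ξ (inner ℝ ξ x) • ξ := by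
    intro x
    simp only [f']
    fun_prop
  have hfi : ∀ x : E, Integrable (fun ξ => f ξ (inner ℝ ξ x)) volume := fun x =>
    hHi.mono' (hfc x).aestronglyMeasurable (.of_forall fun ξ => hfb ξ _)
  have hfi' : ∀ x : E, Integrable (fun ξ => f' ξ (inner ℝ ξ x) • ξ) volume := fun x =>
    hHi'.mono' (hfc' x).aestronglyMeasurable (.of_forall fun ξ => hfb' ξ _)
  have hgf : g = fun x => ∫ ξ, f ξ (inner ℝ ξ x) := by
    funext x
    have h1 : (𝓕⁻ H) x = G x := by rw [FourierTransform.fourierInv_fourier_eq]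
    rw [SchwartzMap.fourierInv_coe, Real.fourierInv_eq] at h1
    have h2 : Integrable (fun ξ => 𝐞 (inner ℝ ξ x) • H ξ) volume := by
      refine (H.integrable (μ := volume)).mono (Continuous.aestronglyMeasurable ?_)
        (.of_forall fun ξ => ?_)
      · simp only [Circle.smul_def]
        fun_prop
      · simp
    have h3 := congrArg Complex.re h1
    rw [← Complex.reCLM_apply, ← Complex.reCLM.integral_comp_comm h2] at h3
    refine h3.symm.trans (integral_congr_ae (.of_forall fun ξ => ?_))
    simp only [Circle.smul_def, Real.fourierChar_apply, smul_eq_mul, Complex.reCLM_apply,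
      Complex.mul_re, Complex.exp_ofReal_mul_I_re, Complex.exp_ofReal_mul_I_im, f]
    ring
  have hgrad : ∀ x, gradient g x = ∫ ξ, f' ξ (inner ℝ ξ x) • ξ := by
    intro x
    refine HasGradientAt.gradient ?_
    rw [hgf, hasGradientAt_iff_hasFDerivAt]
    have h1 := hasFDerivAt_integral_of_dominated_of_fderiv_le (μ := volume)
      (F := fun x ξ => f ξ (inner ℝ ξ x)) (s := univ) (x₀ := x)
      (F' := fun x ξ => (InnerProductSpace.toDual ℝ E) (f' ξ (inner ℝ ξ x) • ξ)) univ_mem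
      (.of_forall fun x => (hfc x).aestronglyMeasurable) (hfi x)
      (((InnerProductSpace.toDual ℝ E).continuous.comp (hfc' x)).aestronglyMeasurable)
      (.of_forall fun ξ x _ => by
        rw [LinearIsometryEquiv.norm_map]
        exact hfb' ξ _) hHi'
      (.of_forall fun ξ x _ => by
        rw [← hasGradientAt_iff_hasFDerivAt]
        simpa using hasGradientAt_comp_inner_add (f := f ξ) (y := ξ) (x := x) (θ := 0)
          (by simpa using hf ξ (inner ℝ ξ x)))
    convert! h1 using 1
    ext v
    rw [ContinuousLinearMap.integral_apply]
    · simp only [InnerProductSpace.toDual_apply_apply, real_inner_comm v]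
      exact (integral_inner (hfi' x) v).symm
    · refine hHi'.mono' ((InnerProductSpace.toDual ℝ E).continuous.comp
        (hfc' x)).aestronglyMeasurable (.of_forall fun ξ => ?_)
      rw [LinearIsometryEquiv.norm_map]
      exact hfb' ξ _
  let c : C(E, C(K, ℝ × E)) := ContinuousMap.curry
    ⟨fun p : E × K => (f p.1 (inner ℝ p.1 (p.2 : E)), f' p.1 (inner ℝ p.1 (p.2 : E)) • p.1), by
      simp only [f, f']
      fun_prop⟩
  have hci : Integrable c volume := by
    refine (hHi.add hHi').mono' c.continuous.aestronglyMeasurable (.of_forall fun ξ => ?_)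
    change ‖c ξ‖ ≤ 2 * ‖H ξ‖ + 2 * Real.pi * 2 * (‖ξ‖ * ‖H ξ‖)
    refine (ContinuousMap.norm_le _ (by positivity)).2 fun x => ?_
    refine (max_le ?_ ?_ : ‖(c ξ) x‖ ≤ _)
    · exact (hfb ξ _).trans (le_add_of_nonneg_right (by positivity))
    · exact (hfb' ξ _).trans (le_add_of_nonneg_left (by positivity))
  refine ⟨∫ ξ, c ξ, M.integral_mem_of_isClosed hM fun ξ => ?_, fun x => ?_⟩
  · exact (h (f ξ) (f' ξ) (hf ξ) (by simp only [f']; fun_prop) ξ).mem fun x => rfl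
  · have h1 := (ContinuousMap.evalCLM ℝ x).integral_comp_comm hci
    simp only [ContinuousMap.evalCLM_apply] at h1
    rw [← h1, hgrad, hgf]
    exact integral_pair (hfi x) (hfi' x)

/-- Mollification commutes with the derivative, and both `g` and `fderiv ℝ g` are uniformly
continuous, so a small bump moves the jet little. -/
theorem isJetIn_gradient_of_contDiff_one [CompactSpace K]
    (hM : IsClosed (M : Set C(K, ℝ × E)))
    (h : ∀ g : E → ℝ, ContDiff ℝ ∞ g → HasCompactSupport g → IsJetIn M g (gradient g))
    {g : E → ℝ} (hg : ContDiff ℝ 1 g) (hgs : HasCompactSupport g) :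
    IsJetIn M g (gradient g) := by
  borelize E
  have hgrad : ∀ {u : E → ℝ}, ContDiff ℝ 1 u → Continuous (gradient u) := fun hu =>
    (InnerProductSpace.toDual ℝ E).symm.continuous.comp (hu.continuous_fderiv one_ne_zero)
  have hg' := hgrad hg
  have hgc := hg.continuous
  refine ⟨⟨fun x => (g x, gradient g x), by fun_prop⟩, ?_, fun x => rfl⟩
  refine Metric.mem_of_closed' hM |>.2 fun ε hε => ?_
  have hdc := hg.continuous_fderiv one_ne_zero
  obtain ⟨δ₁, hδ₁, h1⟩ := Metric.uniformContinuous_iff.1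
    (hgs.uniformContinuous_of_continuous hg.continuous) (ε / 2) (half_pos hε)
  obtain ⟨δ₂, hδ₂, h2⟩ := Metric.uniformContinuous_iff.1
    ((hgs.fderiv ℝ).uniformContinuous_of_continuous hdc) (ε / 2) (half_pos hε)
  let φ : ContDiffBump (0 : E) :=
    ⟨min δ₁ δ₂ / 2, min δ₁ δ₂, by positivity, half_lt_self (by positivity)⟩
  let u := φ.normed volume ⋆[ContinuousLinearMap.lsmul ℝ ℝ, volume] g
  have hu : ContDiff ℝ ∞ u := φ.hasCompactSupport_normed.contDiff_convolution_left (n := ⊤)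
        (ContinuousLinearMap.lsmul ℝ ℝ) φ.contDiff_normed hg.continuous.locallyIntegrable
  have hus : HasCompactSupport u := φ.hasCompactSupport_normed.convolution _ hgs
  have hud : ∀ x, fderiv ℝ u x =
      (φ.normed volume ⋆[ContinuousLinearMap.lsmul ℝ ℝ, volume] fderiv ℝ g) x := fun x =>
    (hgs.hasFDerivAt_convolution_right (ContinuousLinearMap.lsmul ℝ ℝ)
      φ.continuous_normed.locallyIntegrable hg x).fderiv
  obtain ⟨F, hF, hFx⟩ := h u hu hus
  refine ⟨F, hF, ?_⟩
  rw [dist_comm]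
  refine ((ContinuousMap.dist_le (half_pos hε).le).2 fun x => ?_).trans_lt (half_lt_self hε)
  rw [hFx, Prod.dist_eq]
  refine max_le ?_ ?_
  · exact φ.dist_normed_convolution_le hg.continuous.aestronglyMeasurable
      fun y hy => (h1 (hy.trans_le (min_le_left _ _))).le
  · change dist ((InnerProductSpace.toDual ℝ E).symm (fderiv ℝ u x))
      ((InnerProductSpace.toDual ℝ E).symm (fderiv ℝ g x)) ≤ _
    rw [LinearIsometryEquiv.dist_map, hud]
    exact φ.dist_normed_convolution_le hdc.aestronglyMeasurable
      fun y hy => (h2 (hy.trans_le (min_le_right _ _))).le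

/-- Multiply by a smooth cutoff supported in `U` and equal to `1` near `K`. Agreement on
neighbourhoods, not just on `K`, transfers the gradient. -/
theorem ContDiffOn.exists_hasCompactSupport_eventuallyEq {U : Set E} (hK : IsCompact K)
    (hU : IsOpen U) (hKU : K ⊆ U) {k : ℕ∞} {g : E → ℝ} (hg : ContDiffOn ℝ k g U) :
    ∃ u : E → ℝ, ContDiff ℝ k u ∧ HasCompactSupport u ∧ ∀ x ∈ K, u =ᶠ[𝓝 x] g := by
  obtain ⟨δ, hδ, hδU⟩ := hK.exists_cthickening_subset_open hU hKU
  obtain ⟨χ, hχ, -, hχs, hχ1⟩ := exists_contMDiff_support_eq_eq_one_iff (modelWithCornersSelf ℝ E)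
    (n := ⊤) (Metric.isOpen_thickening (δ := δ) (E := K))
    (Metric.isClosed_cthickening (δ := δ / 2) (E := K))
    (Metric.cthickening_subset_thickening' hδ (half_lt_self hδ) K)
  have hts : tsupport χ ⊆ Metric.cthickening δ K := by
    rw [tsupport, hχs]
    exact Metric.closure_thickening_subset_cthickening δ K
  have hc : HasCompactSupport χ := hK.cthickening.of_isClosed_subset (isClosed_tsupport χ) hts
  refine ⟨fun x => χ x * g x, ?_, hc.mul_right, fun x hx => ?_⟩
  · refine contDiff_iff_contDiffAt.2 fun x => ?_
    by_cases hx : x ∈ tsupport χ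
    · exact ((hχ.contDiff.of_le (by exact_mod_cast le_top)).contDiffAt).mul
        (hg.contDiffAt (hU.mem_nhds (hδU (hts hx))))
    · refine contDiffAt_const (c := (0 : ℝ)) |>.congr_of_eventuallyEq ?_
      filter_upwards [notMem_tsupport_iff_eventuallyEq.1 hx] with y hy
      simp [hy]
  · filter_upwards [Metric.isOpen_thickening.mem_nhds
      (Metric.self_subset_thickening (half_pos hδ) K hx)] with y hy
    rw [(hχ1 y).1 (Metric.thickening_subset_cthickening _ _ hy), one_mul]

end Density

/-! ### Density of networks in the `C^1` topology -/

section Network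

variable {n k : ℕ} {Ω : Set (EuclideanSpace ℝ (Fin n))}

theorem IsCkOn.contDiffAt {u : EuclideanSpace ℝ (Fin n) → ℝ} (hu : IsCkOn k u Ω)
    {x : EuclideanSpace ℝ (Fin n)} (hx : x ∈ Ω) : ContDiffAt ℝ k u x := by
  obtain ⟨U, hU, hΩU, hu⟩ := hu
  exact hu.contDiffAt (hU.mem_nhds (hΩU hx))

theorem IsCkOn.continuousOn {u : EuclideanSpace ℝ (Fin n) → ℝ} (hu : IsCkOn k u Ω) :
    ContinuousOn u Ω :=
  fun _ hx => (hu.contDiffAt hx).continuousAt.continuousWithinAt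

theorem IsCkOn.continuousOn_gradient (hk : 1 ≤ k) {u : EuclideanSpace ℝ (Fin n) → ℝ}
    (hu : IsCkOn k u Ω) : ContinuousOn (gradient u) Ω := by
  intro x hx
  have h1 := ((hu.contDiffAt hx).fderiv_right (m := 0)
    (by simpa using (by exact_mod_cast hk : (1 : ℕ∞ω) ≤ k))).continuousAt
  exact ((InnerProductSpace.toDual ℝ _).symm.continuous.continuousAt.comp h1).continuousWithinAt

theorem IsShallowNetwork.contDiff {σ : ℝ → ℝ} (hσ : ContDiff ℝ k σ)
    {u : EuclideanSpace ℝ (Fin n) → ℝ} (hu : IsShallowNetwork σ u) : ContDiff ℝ k u := by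
  obtain ⟨N, a, y, θ, hu⟩ := hu
  rw [funext hu]
  exact ContDiff.sum fun j _ => contDiff_const.mul
    (hσ.comp ((contDiff_const.inner ℝ contDiff_id).add contDiff_const))

/-- The `1`-jets on `Ω` of the shallow networks with a single neuron. -/
def neuronJets (Ω : Set (EuclideanSpace ℝ (Fin n))) (σ : ℝ → ℝ) :
    Set C(Ω, ℝ × EuclideanSpace ℝ (Fin n)) :=
  {F | ∃ (y : EuclideanSpace ℝ (Fin n)) (θ : ℝ), ∀ x : Ω,
    F x = (σ (inner ℝ y (x : EuclideanSpace ℝ (Fin n)) + θ),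
      deriv σ (inner ℝ y (x : EuclideanSpace ℝ (Fin n)) + θ) • y)}

theorem exists_isShallowNetwork_of_mem_span {σ : ℝ → ℝ} (hσ : Differentiable ℝ σ)
    {F : C(Ω, ℝ × EuclideanSpace ℝ (Fin n))} (hF : F ∈ Submodule.span ℝ (neuronJets Ω σ)) :
    ∃ u, IsShallowNetwork σ u ∧ ∀ x : Ω, F x = (u x, gradient u x) := by
  obtain ⟨N, a, G, rfl⟩ := Submodule.mem_span_set'.1 hF
  choose y θ hG using fun j => (G j).2
  refine ⟨fun x => ∑ j, a j * σ (inner ℝ (y j) x + θ j), ⟨N, a, y, θ, fun x => rfl⟩, fun x => ?_⟩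
  have h1 : HasGradientAt (fun x => ∑ j, a j * σ (inner ℝ (y j) x + θ j))
      (∑ j, a j • deriv σ (inner ℝ (y j) (x : EuclideanSpace ℝ (Fin n)) + θ j) • y j) x := by
    rw [hasGradientAt_iff_hasFDerivAt]
    refine (HasFDerivAt.fun_sum fun j _ => (hasGradientAt_iff_hasFDerivAt.1
      (hasGradientAt_comp_inner_add (hσ _).hasDerivAt)).const_mul (a j)).congr_fderiv ?_
    ext v
    simp
  rw [h1.gradient, ContinuousMap.sum_apply]
  simp only [ContinuousMap.smul_apply, hG]
  ext1
  · simp [Prod.fst_sum]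
  · simp [Prod.snd_sum]

/-- Shallow networks with a non-polynomial `C^1` activation are dense, with respect to uniform
convergence on a compact set of the functions and of their gradients, in the `C^k` functions. -/
theorem exists_isShallowNetwork_jet_mem (hΩ : IsCompact Ω) (hk : 1 ≤ k) {σ : ℝ → ℝ}
    (hσ : ContDiff ℝ 1 σ) (hσp : IsNonPolynomial σ) {g : EuclideanSpace ℝ (Fin n) → ℝ}
    (hg : IsCkOn k g Ω) {O : Set C(Ω, ℝ × EuclideanSpace ℝ (Fin n))} (hO : IsOpen O)
    {G : C(Ω, ℝ × EuclideanSpace ℝ (Fin n))} (hG : ∀ x : Ω, G x = (g x, gradient g x))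
    (hGO : G ∈ O) :
    ∃ u, IsShallowNetwork σ u ∧ ∃ F ∈ O, ∀ x : Ω, F x = (u x, gradient u x) := by
  have := isCompact_iff_compactSpace.1 hΩ
  let M := (Submodule.span ℝ (neuronJets Ω σ)).topologicalClosure
  have hM : IsClosed (M : Set C(Ω, ℝ × EuclideanSpace ℝ (Fin n))) :=
    Submodule.isClosed_topologicalClosure _
  have hσ' : Continuous (deriv σ) := hσ.continuous_deriv le_rfl
  have hσc := hσ.continuous
  have hr : ContainsRidges M σ (deriv σ) := fun y θ =>
    ⟨⟨fun x => (σ (inner ℝ y (x : EuclideanSpace ℝ (Fin n)) + θ),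
      deriv σ (inner ℝ y (x : EuclideanSpace ℝ (Fin n)) + θ) • y), by fun_prop⟩,
      Submodule.le_topologicalClosure _ (Submodule.subset_span ⟨y, θ, fun x => rfl⟩), fun x => rfl⟩
  obtain ⟨U, hU, hΩU, hgU⟩ := hg
  obtain ⟨u, hu, hus, hug⟩ := ContDiffOn.exists_hasCompactSupport_eventuallyEq hΩ hU hΩU
    (k := 1) (hgU.of_le (by exact_mod_cast hk))
  have hj : IsJetIn M u (gradient u) := by
    refine isJetIn_gradient_of_contDiff_one hM (fun v hv hvs => ?_) hu hus
    exact isJetIn_gradient_of_contDiff_infty hM (fun f f' hf hf' y =>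
      isJetIn_ridge hM (isJetIn_pow hM hσ hσp hr) hf hf' y) hv hvs
  have hGM : G ∈ M := hj.mem fun x => by
    rw [hG, gradient, gradient, (hug x x.2).fderiv_eq, (hug x x.2).eq_of_nhds]
  obtain ⟨F, hFO, hF⟩ := mem_closure_iff.1
    (show G ∈ closure (Submodule.span ℝ (neuronJets Ω σ) : Set _) from hGM) O hO hGO
  obtain ⟨v, hv, hvF⟩ := exists_isShallowNetwork_of_mem_span (hσ.differentiable one_ne_zero) hF
  exact ⟨v, hv, F, hFO, hvF⟩

end Network

/-! ### Continuity of the functional in the jet -/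

section Functional

theorem ContinuousOn.memLp_restrict_of_isCompact {X V : Type*} [TopologicalSpace X]
    [T2Space X] [MeasurableSpace X] [OpensMeasurableSpace X] [NormedAddCommGroup V]
    [SecondCountableTopology V] {μ : Measure X} [IsFiniteMeasureOnCompacts μ] {s : Set X}
    (hs : IsCompact s) {f : X → V} (hf : ContinuousOn f s) (p : ENNReal) :
    MemLp f p (μ.restrict s) := by
  have : IsFiniteMeasure (μ.restrict s) := ⟨by simpa using hs.measure_lt_top⟩
  borelize V
  obtain ⟨C, hC⟩ := (hs.image_of_continuousOn hf).isBounded.exists_norm_le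
  exact MemLp.of_bound (hf.aemeasurable hs.measurableSet).aestronglyMeasurable C
    (ae_restrict_of_forall_mem hs.measurableSet fun x hx => hC _ ⟨x, hx, rfl⟩)

theorem MeasureTheory.MemLp.toReal_eLpNorm_two_sq {X : Type*} [MeasurableSpace X] {μ : Measure X}
    {f : X → ℝ} (hf : MemLp f 2 μ) : (eLpNorm f 2 μ).toReal ^ 2 = ∫ x, f x ^ 2 ∂μ := by
  have h0 : 0 ≤ ∫ x, f x ^ 2 ∂μ := integral_nonneg fun x => sq_nonneg _
  rw [hf.eLpNorm_eq_integral_rpow_norm two_ne_zero ENNReal.ofNat_ne_top]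
  simp only [ENNReal.toReal_ofNat, Real.rpow_two, Real.norm_eq_abs, sq_abs]
  rw [ENNReal.toReal_ofReal (Real.rpow_nonneg h0 _), ← Real.rpow_natCast, ← Real.rpow_mul h0]
  norm_num

/-- A continuous integrand defines a continuous functional on continuous functions on a
compact set. -/
theorem continuous_integral_comp_continuousMap {X V : Type*} [TopologicalSpace X]
    [CompactSpace X] [T2Space X] [MeasurableSpace X] [BorelSpace X] {μ : Measure X}
    [IsFiniteMeasure μ] [TopologicalSpace V] (Ψ : C(X × V, ℝ)) :
    Continuous fun F : C(X, V) => ∫ x, Ψ (x, F x) ∂μ := by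
  -- Evaluation is jointly continuous on a compact space, so currying makes `F ↦ Ψ(·, F ·)`
  -- continuous; integration is then Lipschitz.
  let T : C(C(X, V), C(X, ℝ)) := ContinuousMap.curry ⟨fun p => Ψ (p.2, p.1 p.2), by fun_prop⟩
  have hi : ∀ f : C(X, ℝ), Integrable f μ := fun f =>
    f.continuous.integrable_of_hasCompactSupport (.of_compactSpace f)
  have h1 : LipschitzWith (μ.real univ).toNNReal fun f : C(X, ℝ) => ∫ x, f x ∂μ := by
    refine LipschitzWith.of_dist_le_mul fun f g => ?_
    rw [Real.coe_toNNReal _ measureReal_nonneg, mul_comm, dist_eq_norm, ← integral_sub (hi f) (hi g)]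
    exact norm_integral_le_of_norm_le_const (.of_forall fun x => by
      rw [← dist_eq_norm]
      exact ContinuousMap.dist_apply_le_dist x)
  exact h1.continuous.comp T.continuous

variable {n k : ℕ} {Ω : Set (EuclideanSpace ℝ (Fin n))}
  {φ : EuclideanSpace ℝ (Fin n) × ℝ × EuclideanSpace ℝ (Fin n) → ℝ}
  {h u : EuclideanSpace ℝ (Fin n) → ℝ}

theorem IsCkOn.integrableOn_comp_jet (hk : 1 ≤ k) (hΩ : IsCompact Ω)
    (hφ : ContinuousOn φ (Ω ×ˢ (Set.univ : Set (ℝ × EuclideanSpace ℝ (Fin n)))))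
    (hu : IsCkOn k u Ω) : IntegrableOn (fun x => φ (x, u x, gradient u x)) Ω volume := by
  refine ContinuousOn.integrableOn_compact hΩ (hφ.comp (continuousOn_id.prodMk
    (hu.continuousOn.prodMk (hu.continuousOn_gradient hk))) fun x hx => ⟨hx, mem_univ _⟩)

theorem IsCkOn.memLp_sub (hΩ : IsCompact Ω) (hu : IsCkOn k u Ω) (hh : IsCkOn k h Ω) :
    MemLp (fun x => u x - h x) 2 (volume.restrict Ω) :=
  (hu.continuousOn.sub hh.continuousOn).memLp_restrict_of_isCompact hΩ 2

/-- As a single integral the functional depends on `u` only through its jet, with a continuous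
integrand. -/
theorem movementFunctional_eq_integral (hk : 1 ≤ k) (hΩ : IsCompact Ω)
    (hφ : ContinuousOn φ (Ω ×ˢ (Set.univ : Set (ℝ × EuclideanSpace ℝ (Fin n))))) (τ : ℝ)
    (hh : IsCkOn k h Ω) (hu : IsCkOn k u Ω) :
    movementFunctional Ω φ τ h u =
      ∫ x in Ω, (φ (x, u x, gradient u x) + (u x - h x) ^ 2 / (2 * τ)) := by
  have hm := hu.memLp_sub hΩ hh
  rw [integral_add (hu.integrableOn_comp_jet hk hΩ hφ) (hm.integrable_sq.div_const _),
    integral_div, ← hm.toReal_eLpNorm_two_sq]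
  rfl

end Functional

/-! ### The approximation theorem -/

theorem mainTheorem2 (n k : ℕ) (hk : 1 ≤ k)
    (Ω : Set (EuclideanSpace ℝ (Fin n))) (hΩ : IsCompact Ω)
    (φ : EuclideanSpace ℝ (Fin n) × ℝ × EuclideanSpace ℝ (Fin n) → ℝ)
    (hφ : ContinuousOn φ (Ω ×ˢ (Set.univ : Set (ℝ × EuclideanSpace ℝ (Fin n)))))
    (τ : ℝ) (hτ : 0 < τ)
    (σ : ℝ → ℝ) (hσ : ContDiff ℝ k σ) (hσp : IsNonPolynomial σ)
    (g h : EuclideanSpace ℝ (Fin n) → ℝ) (hg : IsCkOn k g Ω) (hh : IsCkOn k h Ω) :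
    -- both terms of the functional are well defined and finite for every `C^k` function `u` on `Ω`
    (∀ u : EuclideanSpace ℝ (Fin n) → ℝ, IsCkOn k u Ω →
      IntegrableOn (fun x => φ (x, u x, gradient u x)) Ω volume ∧
      MemLp (fun x => u x - h x) 2 (volume.restrict Ω)) ∧
    ∀ ε : ℝ, 0 < ε → ∃ u : EuclideanSpace ℝ (Fin n) → ℝ,
      IsShallowNetwork σ u ∧ IsCkOn k u Ω ∧
      (∀ x ∈ Ω, |u x - g x| ≤ ε) ∧
      eLpNorm (fun x => u x - g x) ⊤ (volume.restrict Ω) ≤ ENNReal.ofReal ε ∧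
      movementFunctional Ω φ τ h u - movementFunctional Ω φ τ h g ≤ ε := by
  refine ⟨fun u hu => ⟨hu.integrableOn_comp_jet hk hΩ hφ, hu.memLp_sub hΩ hh⟩, fun ε hε => ?_⟩
  have := isCompact_iff_compactSpace.1 hΩ
  let μ : Measure Ω := volume.comap Subtype.val
  have : IsFiniteMeasure μ := ⟨by
    rw [comap_subtype_coe_apply hΩ.measurableSet, image_univ, Subtype.range_coe]
    exact hΩ.measure_lt_top⟩
  let Ψ : C(Ω × (ℝ × EuclideanSpace ℝ (Fin n)), ℝ) :=
    ⟨fun p => φ (p.1, p.2) + (p.2.1 - h p.1) ^ 2 / (2 * τ), by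
      have h1 : Continuous fun p : Ω × (ℝ × EuclideanSpace ℝ (Fin n)) =>
          φ ((p.1 : EuclideanSpace ℝ (Fin n)), p.2) :=
        hφ.comp_continuous (by fun_prop) fun p => ⟨p.1.2, mem_univ _⟩
      have h2 : Continuous fun x : Ω => h x :=
        continuousOn_iff_continuous_domRestrict.1 hh.continuousOn
      exact h1.add (((continuous_fst.comp continuous_snd).sub
        (h2.comp continuous_fst)).pow 2 |>.div_const _)⟩
  have hI : ∀ (u : EuclideanSpace ℝ (Fin n) → ℝ) (F : C(Ω, ℝ × EuclideanSpace ℝ (Fin n))),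
      IsCkOn k u Ω → (∀ x : Ω, F x = (u x, gradient u x)) →
      movementFunctional Ω φ τ h u = ∫ x, Ψ (x, F x) ∂μ := by
    intro u F hu hF
    rw [movementFunctional_eq_integral hk hΩ hφ τ hh hu,
      ← integral_subtype_comap hΩ.measurableSet]
    exact integral_congr_ae (.of_forall fun x => by simp only [hF]; rfl)
  let G : C(Ω, ℝ × EuclideanSpace ℝ (Fin n)) := ⟨fun x => (g x, gradient g x),
    (continuousOn_iff_continuous_domRestrict.1 hg.continuousOn).prodMk
      (continuousOn_iff_continuous_domRestrict.1 (hg.continuousOn_gradient hk))⟩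
  obtain ⟨u, hu, F, ⟨hFG, hFI⟩, huF⟩ := exists_isShallowNetwork_jet_mem hΩ hk
    (hσ.of_le (by exact_mod_cast hk)) hσp hg
    -- The ball gives uniform closeness to `g`; the second set, open by continuity of the
    -- functional, gives the energy bound.
    (O := Metric.ball G ε ∩ {F | ∫ x, Ψ (x, F x) ∂μ < ∫ x, Ψ (x, G x) ∂μ + ε})
    (Metric.isOpen_ball.inter
      (isOpen_lt (continuous_integral_comp_continuousMap Ψ) continuous_const))
    (fun x => rfl) ⟨Metric.mem_ball_self hε, lt_add_of_pos_right _ hε⟩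
  have huk : IsCkOn k u Ω := ⟨univ, isOpen_univ, subset_univ _, (hu.contDiff hσ).contDiffOn⟩
  have hug : ∀ x ∈ Ω, |u x - g x| ≤ ε := by
    intro x hx
    have h1 := (ContinuousMap.dist_apply_le_dist (f := F) (g := G) ⟨x, hx⟩).trans hFG.le
    rw [huF] at h1
    exact (le_max_left _ _).trans h1
  refine ⟨u, hu, huk, hug, ?_, ?_⟩
  · rw [eLpNorm_exponent_top]
    exact eLpNormEssSup_le_of_ae_bound (ae_restrict_of_forall_mem hΩ.measurableSet hug)
  · rw [hI u F huk huF, hI g G hg fun x => rfl]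
    rw [mem_ofPred_eq] at hFI
    linarith
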